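/- Let $[n]=\{1,\dots,n\}$. For $x\in\{\pm1\}^{[n]}$ let $O_x$ be the $n\times n$ diagonal matrix with $O_x|i\rangle=x_i|i\rangle$. For a function $g\colon\{\pm1\}^{V}\to\mathbb{C}$ ($V$ finite) and $S\subseteq V$ let $\hat g(S)=\mathbb{E}_x\big[g(x)\prod_{i\in S}x_i\big]$, with $x$ uniform in $\{\pm1\}^V$, and for an integer $\ell\ge0$ let $L_{1,\ell}(g)=\sum_{S\subseteq V,\,|S|=\ell}|\hat g(S)|$. There is a function $\kappa(d,\ell)\ge 0$ with $\kappa(d,\ell)=O(d\ell)\cdot\min\{2^{d\ell},\ell^{2^d}\}$, i.e. $\kappa(d,\ell)\le C\,d\ell\cdot\min\{2^{d\ell},\ell^{2^d}\}$ for all integers $d\ge2$, $\ell\ge0$ with one universal constant $C>0$, such that the following holds. Let $n,t\ge1$, $m\ge0$ and $d\ge2$ be integers and let $A=[n]^t\times[m]$. Let $u,v\in\mathbb{C}^A$ be unit vectors (in the $\ell_2$-norm) and let $M_1,\dots,M_{d-1}\in\mathbb{C}^{A\times A}$ be matrices of operator norm $\|M_i\|\le1$. Define $f\colon\{\pm1\}^{[n]}\to\mathbb{C}$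 by $$f(x)=u^\dagger\big(O_x^{\otimes t}\otimes I_m\big)M_1\big(O_x^{\otimes t}\otimes I_m\big)M_2\cdots M_{d-1}\big(O_x^{\otimes t}\otimes I_m\big)v .$$ Let $\rho\in\{\pm1,*\}^{[n]}$ be an arbitrary restriction, let $\tilde n=|\rho^{-1}(*)|$, and let $f|_\rho\colon\{\pm1\}^{\rho^{-1}(*)}\to\mathbb{C}$ be obtained from $f$ by fixing $x_i=\rho(i)$ for every $i\notin\rho^{-1}(*)$. Then for every integer $\ell\ge0$, $$L_{1,\ell}(f|_\rho)\le 2^{\kappa(d,\ell)}\cdot t^\ell\cdot\max\Big\{1,(\tilde n/t)^{\frac12\lfloor (d-1)\ell/d\rfloor}\Big\}.$$ -/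

import Mathlib

open scoped Matrix Kronecker Matrix.Norms.L2Operator

namespace QueryFourier

/-- The index set `A = [n]^t × [m]` of query registers and workspace. -/
abbrev Idx (n t m : ℕ) : Type := (Fin t → Fin n) × Fin m

/-- The phase oracle `O_x |i⟩ = x_i |i⟩` on `ℂ^n`, for `x ∈ {±1}^n` (the group `ℤˣ` is `{±1}`). -/
def oracle {n : ℕ} (x : Fin n → ℤˣ) : Matrix (Fin n) (Fin n) ℂ :=
  Matrix.diagonal fun i => ((x i : ℤ) : ℂ)

/-- The `t`-fold tensor power of a matrix, with rows and columns indexed by `t`-tuples. -/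
def tensorPow {n : ℕ} (t : ℕ) (M : Matrix (Fin n) (Fin n) ℂ) :
    Matrix (Fin t → Fin n) (Fin t → Fin n) ℂ :=
  Matrix.of fun I J => ∏ k, M (I k) (J k)

/-- One layer of `t` parallel queries: `O_x^{⊗t} ⊗ I_m`. -/
def queryLayer {n : ℕ} (t m : ℕ) (x : Fin n → ℤˣ) : Matrix (Idx n t m) (Idx n t m) ℂ :=
  tensorPow t (oracle x) ⊗ₖ (1 : Matrix (Fin m) (Fin m) ℂ)

/-- `f(x) = u† Q_x M_1 Q_x M_2 Q_x ⋯ M_{d-1} Q_x v` where `Q_x = O_x^{⊗t} ⊗ I_m`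
(`M_1, …, M_{d-1}` are `M 0, …, M (d-2)`). -/
noncomputable def queryFun {n t m d : ℕ} (u v : EuclideanSpace ℂ (Idx n t m))
    (M : Fin (d - 1) → Matrix (Idx n t m) (Idx n t m) ℂ) (x : Fin n → ℤˣ) : ℂ :=
  star u.ofLp ⬝ᵥ
    ((queryLayer t m x * (List.ofFn fun i => M i * queryLayer t m x).prod) *ᵥ v.ofLp)

/-- The free variables `ρ⁻¹(*)` of a restriction `ρ ∈ {±1, *}^n`; `none` plays the role of `*`. -/
abbrev Free {n : ℕ} (ρ : Fin n → Option ℤˣ) : Type := {i : Fin n // ρ i = none}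

/-- The subfunction `f|_ρ`, a function of the free variables. -/
def restrict {n : ℕ} (f : (Fin n → ℤˣ) → ℂ) (ρ : Fin n → Option ℤˣ) : (Free ρ → ℤˣ) → ℂ :=
  fun y => f fun i => if h : ρ i = none then y ⟨i, h⟩ else (ρ i).getD 1

/-- The Fourier coefficient `f̂(S) = E_x[f(x) ∏_{i ∈ S} x_i]`, `x` uniform over `{±1}^ι`. -/
noncomputable def fourierCoeff {ι : Type} [Fintype ι] [DecidableEq ι] (f : (ι → ℤˣ) → ℂ)
    (S : Finset ι) : ℂ :=
  (∑ x : ι → ℤˣ, f x * ∏ i ∈ S, ((x i : ℤ) : ℂ)) / 2 ^ Fintype.card ι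

/-- The level-`ℓ` Fourier `ℓ₁`-weight `L_{1,ℓ}(f) = ∑_{|S| = ℓ} |f̂(S)|`. -/
noncomputable def fourierWeight {ι : Type} [Fintype ι] [DecidableEq ι] (ℓ : ℕ)
    (f : (ι → ℤˣ) → ℂ) : ℝ :=
  ∑ S ∈ Finset.powersetCard ℓ (Finset.univ : Finset ι), ‖fourierCoeff f S‖

end QueryFourier

/-!
After a restriction `ρ`, a query layer is diagonal, with entries a fixed sign times the character of
the set `T a` of free variables that occur an odd number of times among the queries of the basis
state `a`; this set has at most `t` elements (`queryLayer_restrict`, `card_oddSet_le`). So the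
restricted function is `u† N₁ D_y N₂ D_y ⋯ N_d D_y v` with contractions `N_j` and diagonal unitaries
`D_y` (`restrict_queryFun`).

Expand it as a sum over paths `a₁, …, a_d` of basis states. A path contributes to the coefficient
of `S` only if every `i ∈ S` lies in an odd number of the sets `T a_j`, so the indicator of this
event may be inserted under the average over `y` (`sum_prod_char_mul_char`). For each `i` that
indicator is a combination of the products `∏_{j ∈ W} 1[i ∈ T a_j]` over nonempty sets `W` of layers
(`parity_eq_sum`). Resumming the paths gives, for each `y` and each pattern assigning to every
variable of `S` its set `W`, a term `u† N₁ D_y P₁ ⋯ N_d D_y P_d v`, where `P_j` projects onto the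
basis states whose set contains all the variables with `j ∈ W` (`fourierCoeff_layered`).

For fixed `y` and a fixed pattern this term is summed in absolute value over all `ℓ`-tuples of
variables. Split it at a pivot layer `j`, with `P_j = P_j P_j`, and use Cauchy–Schwarz. In the sum of
squared norms of either half, a variable that occurs in one of its layers costs a factor `t`,
since `∑_i ‖P_i w‖² ≤ t ‖w‖²`, and any other variable a factor `ñ`
(`exists_tupleBound_layerProd`). Variables required at the pivot occur in both halves and all others
in at least one, so if `k` variables are required at the pivot the sum is at most
`t^ℓ (ñ/t)^((ℓ - k)/2)` when `t ≤ ñ` (`sum_norm_layerProd_le`). By pigeonhole some layer has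
`k ≥ ℓ/d`, which is the claimed exponent (`sum_norm_patternLayers_le`). There are at most `2^(dℓ)`
patterns, with coefficients at most `2^(dℓ)`, hence `κ = 2dℓ`.
-/

set_option linter.unusedSectionVars false

namespace QueryFourier

/-! ### Sums over tuples of variables -/

section Tuples

variable {A V ι : Type} [Fintype A] [DecidableEq A] [Fintype V] [DecidableEq V]
  [Fintype ι] [DecidableEq ι]

/-- The coordinate projection onto those basis states `a` whose variable set `T a` contains `i s`
for every `s ∈ K`. -/
def mask (T : A → Finset V) (K : Finset ι) (i : ι → V) : Matrix A A ℂ :=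
  Matrix.diagonal fun a => if ∀ s ∈ K, i s ∈ T a then 1 else 0

/-- A family of vectors indexed by tuples `i ∈ V^ι` which depends only on the coordinates of `i`
in `Z`, and whose total squared norm is at most `τ` for every coordinate in `Z` times `|V|` for
every other coordinate. -/
def TupleBound (τ : ℕ) (Z : Finset ι) (W : (ι → V) → A → ℂ) : Prop :=
  (∀ i i' : ι → V, (∀ s ∈ Z, i s = i' s) → W i = W i') ∧
    ∑ i, ∑ a, ‖W i a‖ ^ 2 ≤ (τ : ℝ) ^ Z.card * (Fintype.card V : ℝ) ^ (Zᶜ).card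

lemma sum_norm_sq_mulVec_le {N : Matrix A A ℂ} (hN : ‖N‖ ≤ 1) (w : A → ℂ) :
    ∑ a, ‖(N *ᵥ w) a‖ ^ 2 ≤ ∑ a, ‖w a‖ ^ 2 := by
  have h := Matrix.l2_opNorm_mulVec N (WithLp.toLp 2 w)
  have h2 : ‖WithLp.toLp 2 (N *ᵥ w)‖ ≤ ‖WithLp.toLp 2 w‖ :=
    h.trans (mul_le_of_le_one_left (norm_nonneg _) hN)
  have h3 := pow_le_pow_left₀ (norm_nonneg _) h2 2
  simpa only [EuclideanSpace.norm_sq_eq] using h3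

lemma TupleBound.mulVec {τ : ℕ} {Z : Finset ι} {W : (ι → V) → A → ℂ} (h : TupleBound τ Z W)
    {N : Matrix A A ℂ} (hN : ‖N‖ ≤ 1) : TupleBound τ Z fun i => N *ᵥ W i :=
  ⟨fun i i' hi => by simp only [h.1 i i' hi],
    (Finset.sum_le_sum fun i _ => sum_norm_sq_mulVec_le hN (W i)).trans h.2⟩

lemma tupleBound_const (τ : ℕ) {v : A → ℂ} (hv : ∑ a, ‖v a‖ ^ 2 ≤ 1) :
    TupleBound τ (∅ : Finset ι) fun _ : ι → V => v := by
  refine ⟨fun _ _ _ => rfl, ?_⟩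
  simp only [Finset.sum_const, Finset.card_univ, Fintype.card_fun, nsmul_eq_mul,
    Finset.card_empty, pow_zero, one_mul, Finset.compl_empty, Nat.cast_pow]
  exact mul_le_of_le_one_right (by positivity) hv

/-- If `h` does not depend on coordinate `s`, restricting that coordinate to a set `X` scales the
sum by `|X| / |V|`. -/
lemma card_mul_sum_ite_mem (s : ι) (X : Finset V) {h : (ι → V) → ℝ}
    (hh : ∀ i x, h (Function.update i s x) = h i) :
    (Fintype.card V : ℝ) * ∑ i, (if i s ∈ X then h i else 0) = X.card * ∑ i, h i := by
  -- Exchange the value at `s` with an auxiliary variable.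
  let e : (ι → V) × V → (ι → V) × V := fun q => (Function.update q.1 s q.2, q.1 s)
  have he : Function.Involutive e := fun q => by simp [e]
  have key := Equiv.sum_comp he.toPerm fun q : (ι → V) × V => if q.1 s ∈ X then h q.1 else 0
  simp only [Function.Involutive.coe_toPerm, e, Function.update_self, hh,
    Fintype.sum_prod_type] at key
  simp only [Finset.sum_const, Finset.card_univ, nsmul_eq_mul, ← Finset.mul_sum] at key
  rw [← key, Finset.mul_sum]
  refine Finset.sum_congr rfl fun i _ => ?_
  rw [← Finset.sum_filter]
  simp

lemma mask_insert (T : A → Finset V) (s : ι) (K : Finset ι) (i : ι → V) :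
    mask T (insert s K) i = mask T {s} i * mask T K i := by
  simp only [mask, Matrix.diagonal_mul_diagonal]
  congr 1
  funext a
  by_cases h1 : i s ∈ T a <;> simp [h1]

lemma norm_mask_le (T : A → Finset V) (K : Finset ι) (i : ι → V) : ‖mask T K i‖ ≤ 1 := by
  rw [mask, Matrix.l2_opNorm_diagonal, pi_norm_le_iff_of_nonneg zero_le_one]
  intro a
  split_ifs <;> simp

lemma TupleBound.mask_singleton {T : A → Finset V} {τ : ℕ} (hT : ∀ a, (T a).card ≤ τ)
    {Z : Finset ι} {W : (ι → V) → A → ℂ} (h : TupleBound τ Z W) (s : ι) :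
    TupleBound τ (insert s Z) fun i => mask T {s} i *ᵥ W i := by
  refine ⟨fun i i' hi => ?_, ?_⟩
  · have h1 := h.1 i i' fun r hr => hi r (Finset.mem_insert_of_mem hr)
    have h2 := hi s (Finset.mem_insert_self _ _)
    simp only [h1, mask, Finset.mem_singleton, forall_eq, h2]
  by_cases hs : s ∈ Z
  · rw [Finset.insert_eq_of_mem hs]
    exact (Finset.sum_le_sum fun i _ => sum_norm_sq_mulVec_le (norm_mask_le T _ i) (W i)).trans h.2
  rcases isEmpty_or_nonempty V with hV | hV
  · have : IsEmpty (ι → V) := ⟨fun i => hV.elim (i s)⟩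
    rw [Finset.univ_eq_empty, Finset.sum_empty]
    positivity
  have hn : (0 : ℝ) < Fintype.card V := by exact_mod_cast Fintype.card_pos
  have hcard : (Zᶜ).card = ((insert s Z)ᶜ).card + 1 := by
    have h1 := Finset.card_compl_add_card Z
    have h2 := Finset.card_compl_add_card (insert s Z)
    rw [Finset.card_insert_of_notMem hs] at h2
    omega
  have hW : ∀ a i x, ‖W (Function.update i s x) a‖ ^ 2 = ‖W i a‖ ^ 2 := fun a i x => by
    rw [h.1 (Function.update i s x) i fun r hr =>
      Function.update_of_ne (ne_of_mem_of_not_mem hr hs) _ _]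
  refine le_of_mul_le_mul_left ?_ hn
  calc (Fintype.card V : ℝ) * ∑ i, ∑ a, ‖(mask T {s} i *ᵥ W i) a‖ ^ 2
      = ∑ a, (Fintype.card V : ℝ) * ∑ i, (if i s ∈ T a then ‖W i a‖ ^ 2 else 0) := by
        rw [Finset.sum_comm, Finset.mul_sum]
        refine Finset.sum_congr rfl fun a _ => ?_
        congr 1
        refine Finset.sum_congr rfl fun i _ => ?_
        rw [mask, Matrix.mulVec_diagonal]
        by_cases hi : i s ∈ T a <;> simp [hi]
    _ = ∑ a, ((T a).card : ℝ) * ∑ i, ‖W i a‖ ^ 2 :=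
        Finset.sum_congr rfl fun a _ => card_mul_sum_ite_mem s (T a) (hW a)
    _ ≤ ∑ a, (τ : ℝ) * ∑ i, ‖W i a‖ ^ 2 := by
        gcongr with a
        exact hT a
    _ = τ * ∑ i, ∑ a, ‖W i a‖ ^ 2 := by rw [← Finset.mul_sum, Finset.sum_comm]
    _ ≤ τ * ((τ : ℝ) ^ Z.card * (Fintype.card V : ℝ) ^ (Zᶜ).card) := by
        gcongr
        exact h.2
    _ = _ := by
        rw [Finset.card_insert_of_notMem hs, hcard]
        ring

lemma TupleBound.mask {T : A → Finset V} {τ : ℕ} (hT : ∀ a, (T a).card ≤ τ)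
    {Z : Finset ι} {W : (ι → V) → A → ℂ} (h : TupleBound τ Z W) (K : Finset ι) :
    TupleBound τ (K ∪ Z) fun i => QueryFourier.mask T K i *ᵥ W i := by
  induction K using Finset.induction_on with
  | empty => simpa [QueryFourier.mask] using h
  | insert s K _ ih =>
    have := ih.mask_singleton hT s
    simpa only [mask_insert, Finset.insert_union, Matrix.mulVec_mulVec] using this

/-- The product of the layers `N · mask K`, with `(N, K)` running through a list. -/
def layerProd (T : A → Finset V) (L : List (Matrix A A ℂ × Finset ι)) (i : ι → V) :
    Matrix A A ℂ :=
  (L.map fun q => q.1 * mask T q.2 i).prod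

/-- The squared norm of the vector built from the right, summed over all tuples: each coordinate
pays `τ` instead of `|V|` at the first layer that involves it, and nothing afterwards. -/
lemma exists_tupleBound_layerProd {T : A → Finset V} {τ : ℕ} (hT : ∀ a, (T a).card ≤ τ)
    {v : A → ℂ} (hv : ∑ a, ‖v a‖ ^ 2 ≤ 1) (L : List (Matrix A A ℂ × Finset ι))
    (hL : ∀ q ∈ L, ‖q.1‖ ≤ 1) :
    ∃ Z : Finset ι, (∀ q ∈ L, q.2 ⊆ Z) ∧ TupleBound τ Z fun i => layerProd T L i *ᵥ v := by
  induction L with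
  | nil => exact ⟨∅, by simp, by simpa [layerProd] using tupleBound_const τ hv⟩
  | cons q L ih =>
    obtain ⟨Z, hZ, hb⟩ := ih fun r hr => hL r (List.mem_cons_of_mem _ hr)
    refine ⟨q.2 ∪ Z, ?_, ?_⟩
    · intro r hr
      rcases List.mem_cons.1 hr with rfl | hr
      · exact Finset.subset_union_left
      · exact (hZ r hr).trans Finset.subset_union_right
    · have := (hb.mask hT q.2).mulVec (hL q List.mem_cons_self)
      simpa only [layerProd, List.map_cons, List.prod_cons, Matrix.mulVec_mulVec,
        Matrix.mul_assoc] using this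

lemma conjTranspose_mask (T : A → Finset V) (K : Finset ι) (i : ι → V) :
    (mask T K i)ᴴ = mask T K i := by
  rw [mask, Matrix.diagonal_conjTranspose]
  congr 1
  funext a
  by_cases h : ∀ s ∈ K, i s ∈ T a <;> simp [h]

lemma mask_mul_mask (T : A → Finset V) (K : Finset ι) (i : ι → V) :
    mask T K i * mask T K i = mask T K i := by
  rw [mask, Matrix.diagonal_mul_diagonal]
  congr 1
  funext a
  split_ifs <;> simp

lemma exists_tupleBound_conjTranspose_layerProd {T : A → Finset V} {τ : ℕ}
    (hT : ∀ a, (T a).card ≤ τ) {u : A → ℂ} (hu : ∑ a, ‖u a‖ ^ 2 ≤ 1)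
    (L : List (Matrix A A ℂ × Finset ι)) (hL : ∀ q ∈ L, ‖q.1‖ ≤ 1) :
    ∃ Z : Finset ι, (∀ q ∈ L, q.2 ⊆ Z) ∧ TupleBound τ Z fun i => (layerProd T L i)ᴴ *ᵥ u := by
  induction L using List.reverseRecOn with
  | nil => exact ⟨∅, by simp, by simpa [layerProd] using tupleBound_const τ hu⟩
  | append_singleton L q ih =>
    obtain ⟨Z, hZ, hb⟩ := ih fun r hr => hL r (List.mem_append_left _ hr)
    refine ⟨q.2 ∪ Z, ?_, ?_⟩
    · intro r hr
      rcases List.mem_append.1 hr with hr | hr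
      · exact (hZ r hr).trans Finset.subset_union_right
      · rw [List.mem_singleton.1 hr]
        exact Finset.subset_union_left
    · have hq : ‖q.1ᴴ‖ ≤ 1 := by
        rw [Matrix.l2_opNorm_conjTranspose]
        exact hL q (by simp)
      have := (hb.mulVec hq).mask hT q.2
      simpa only [layerProd, List.map_append, List.map_cons, List.map_nil, List.prod_append,
        List.prod_singleton, Matrix.conjTranspose_mul, conjTranspose_mask, Matrix.mulVec_mulVec,
        Matrix.mul_assoc] using this

/-- Cauchy–Schwarz at the layer `q`, which serves as a pivot: its mask is used twice, once for
the layers to its left and once for those to its right. -/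
lemma sum_norm_layerProd_le {T : A → Finset V} {τ : ℕ} (hT : ∀ a, (T a).card ≤ τ)
    {u v : A → ℂ} (hu : ∑ a, ‖u a‖ ^ 2 ≤ 1) (hv : ∑ a, ‖v a‖ ^ 2 ≤ 1)
    (L : List (Matrix A A ℂ × Finset ι)) (hL : ∀ q ∈ L, ‖q.1‖ ≤ 1)
    (hcover : ∀ s, ∃ q ∈ L, s ∈ q.2) {q : Matrix A A ℂ × Finset ι} (hq : q ∈ L) :
    ∃ b : ℕ, b + q.2.card ≤ Fintype.card ι ∧
      ∑ i, ‖star u ⬝ᵥ (layerProd T L i *ᵥ v)‖ ≤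
        √((τ : ℝ) ^ (2 * Fintype.card ι - b) * (Fintype.card V : ℝ) ^ b) := by
  obtain ⟨L₁, L₂, rfl⟩ := List.append_of_mem hq
  obtain ⟨X, hX, hXb⟩ := exists_tupleBound_conjTranspose_layerProd hT hu (L₁ ++ [q])
    fun r hr => hL r (by simp only [List.mem_append, List.mem_cons] at hr ⊢; tauto)
  obtain ⟨Y, hY, hYb⟩ := exists_tupleBound_layerProd hT hv L₂
    fun r hr => hL r (by simp [hr])
  have hYb' := hYb.mask hT q.2
  set Y' := q.2 ∪ Y
  have hunion : X ∪ Y' = Finset.univ := by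
    refine Finset.eq_univ_of_forall fun s => ?_
    obtain ⟨r, hr, hs⟩ := hcover s
    rcases List.mem_append.1 hr with hr | hr
    · exact Finset.mem_union_left _ (hX r (by simp [hr]) hs)
    · rcases List.mem_cons.1 hr with rfl | hr
      · exact Finset.mem_union_left _ (hX r (by simp) hs)
      · exact Finset.mem_union_right _ (Finset.mem_union_right _ (hY r hr hs))
  have hinter : q.2.card ≤ (X ∩ Y').card :=
    Finset.card_le_card (Finset.subset_inter (hX q (by simp)) Finset.subset_union_left)
  have hcards := Finset.card_union_add_card_inter X Y'
  rw [hunion, Finset.card_univ] at hcards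
  have hXc := Finset.card_compl_add_card X
  have hYc := Finset.card_compl_add_card Y'
  refine ⟨(Xᶜ).card + (Y'ᶜ).card, by omega, ?_⟩
  have hexp : 2 * Fintype.card ι - ((Xᶜ).card + (Y'ᶜ).card) = X.card + Y'.card := by omega
  rw [hexp]
  have hterm : ∀ i, star u ⬝ᵥ (layerProd T (L₁ ++ q :: L₂) i *ᵥ v) =
      star ((layerProd T (L₁ ++ [q]) i)ᴴ *ᵥ u) ⬝ᵥ (mask T q.2 i *ᵥ (layerProd T L₂ i *ᵥ v)) := by
    intro i
    have : layerProd T (L₁ ++ q :: L₂) i =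
        layerProd T (L₁ ++ [q]) i * (mask T q.2 i * layerProd T L₂ i) := by
      simp only [layerProd, List.map_append, List.map_cons, List.prod_append, List.prod_cons,
        List.map_nil, List.prod_nil, Matrix.mul_assoc, mul_one]
      rw [← Matrix.mul_assoc (mask T q.2 i) (mask T q.2 i), mask_mul_mask]
    rw [this, Matrix.star_mulVec, Matrix.conjTranspose_conjTranspose, ← Matrix.dotProduct_mulVec,
      Matrix.mulVec_mulVec, Matrix.mulVec_mulVec, Matrix.mul_assoc]
  set l : (ι → V) → A → ℂ := fun i => (layerProd T (L₁ ++ [q]) i)ᴴ *ᵥ u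
  set r : (ι → V) → A → ℂ := fun i => mask T q.2 i *ᵥ (layerProd T L₂ i *ᵥ v)
  calc ∑ i, ‖star u ⬝ᵥ (layerProd T (L₁ ++ q :: L₂) i *ᵥ v)‖
      ≤ ∑ i, ∑ a, ‖l i a‖ * ‖r i a‖ := by
        refine Finset.sum_le_sum fun i _ => ?_
        rw [hterm]
        refine (norm_sum_le _ _).trans (Finset.sum_le_sum fun a _ => ?_)
        rw [norm_mul, Pi.star_apply, norm_star]
    _ = ∑ x : (ι → V) × A, ‖l x.1 x.2‖ * ‖r x.1 x.2‖ := by rw [Fintype.sum_prod_type]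
    _ ≤ √(∑ x : (ι → V) × A, ‖l x.1 x.2‖ ^ 2) * √(∑ x : (ι → V) × A, ‖r x.1 x.2‖ ^ 2) :=
        Real.sum_mul_le_sqrt_mul_sqrt _ _ _
    _ ≤ √((τ : ℝ) ^ X.card * (Fintype.card V : ℝ) ^ (Xᶜ).card) *
          √((τ : ℝ) ^ Y'.card * (Fintype.card V : ℝ) ^ (Y'ᶜ).card) := by
        rw [Fintype.sum_prod_type, Fintype.sum_prod_type]
        exact mul_le_mul (Real.sqrt_le_sqrt hXb.2) (Real.sqrt_le_sqrt hYb'.2)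
          (Real.sqrt_nonneg _) (Real.sqrt_nonneg _)
    _ = _ := by
        rw [← Real.sqrt_mul (by positivity)]
        congr 1
        ring

end Tuples
/-! ### Characters and parities -/

section Parity

variable {V : Type} [Fintype V] [DecidableEq V]

lemma prod_mulSingle_neg_one (v : V) (X : Finset V) :
    ∏ w ∈ X, (((Pi.mulSingle v (-1) : V → ℤˣ) w : ℤ) : ℂ) = if v ∈ X then -1 else 1 := by
  have h : ∀ w, (((Pi.mulSingle v (-1) : V → ℤˣ) w : ℤ) : ℂ) = if w = v then -1 else 1 := by
    intro w
    by_cases hw : w = v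
    · subst hw
      simp
    · simp [hw]
  simp only [h]
  rw [Finset.prod_ite_eq' X v fun _ => (-1 : ℂ)]

/-- Averaged against the character of `S`, a product of characters may be multiplied by the
indicator that each `i ∈ S` lies in an odd number of the sets: otherwise the average vanishes. -/
lemma sum_prod_char_mul_char {d : ℕ} (S : Finset V) (X : Fin d → Finset V) :
    ∑ y : V → ℤˣ, (∏ j, ∏ w ∈ X j, ((y w : ℤ) : ℂ)) * ∏ w ∈ S, ((y w : ℤ) : ℂ) =
      ∑ y : V → ℤˣ, ((∏ j, ∏ w ∈ X j, ((y w : ℤ) : ℂ)) * ∏ w ∈ S, ((y w : ℤ) : ℂ)) *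
        ∏ i ∈ S, ((1 - ∏ j, (1 - 2 * (if i ∈ X j then 1 else 0) : ℂ)) / 2) := by
  have hsign : ∀ i, (∏ j, (1 - 2 * (if i ∈ X j then 1 else 0) : ℂ)) =
      ∏ j, (if i ∈ X j then -1 else 1 : ℂ) := fun i =>
    Finset.prod_congr rfl fun j _ => by split_ifs <;> norm_num
  have hpm : ∀ i, (∏ j, (if i ∈ X j then -1 else 1 : ℂ)) = 1 ∨
      (∏ j, (if i ∈ X j then -1 else 1 : ℂ)) = -1 := fun i =>
    Finset.prod_induction _ (fun z : ℂ => z = 1 ∨ z = -1)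
      (by rintro a b (rfl | rfl) (rfl | rfl) <;> simp) (Or.inl rfl)
      fun j _ => by split_ifs <;> simp
  simp only [hsign]
  by_cases hall : ∀ i ∈ S, (∏ j, (if i ∈ X j then -1 else 1 : ℂ)) = -1
  · rw [Finset.prod_eq_one fun i hi => by rw [hall i hi]; norm_num]
    simp
  push Not at hall
  obtain ⟨v, hv, hne⟩ := hall
  have hv1 := (hpm v).resolve_right hne
  have hzero : (∏ i ∈ S, ((1 - ∏ j, (if i ∈ X j then -1 else 1 : ℂ)) / 2)) = 0 :=
    Finset.prod_eq_zero hv (by rw [hv1]; norm_num)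
  simp only [hzero, mul_zero, Finset.sum_const_zero]
  -- Flipping the variable `v` changes the sign of every summand.
  have hflip := Equiv.sum_comp (Equiv.mulRight (Pi.mulSingle v (-1) : V → ℤˣ))
    fun y => (∏ j, ∏ w ∈ X j, ((y w : ℤ) : ℂ)) * ∏ w ∈ S, ((y w : ℤ) : ℂ)
  simp only [Equiv.coe_mulRight, Pi.mul_apply, Units.val_mul, Int.cast_mul,
    Finset.prod_mul_distrib, prod_mulSingle_neg_one, hv1, if_pos hv] at hflip
  simp only [mul_one, mul_neg, Finset.sum_neg_distrib] at hflip
  exact self_eq_neg.1 hflip.symm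

/-- Coefficient of the set `W` of layers in the expansion of the indicator of odd parity as a
combination of products. -/
noncomputable def parityCoeff {d : ℕ} (W : Finset (Fin d)) : ℂ :=
  if W = ∅ then 0 else -(-2) ^ W.card / 2

lemma parity_eq_sum {d : ℕ} (e : Fin d → ℂ) :
    (1 - ∏ j, (1 - 2 * e j)) / 2 = ∑ W : Finset (Fin d), parityCoeff W * ∏ j ∈ W, e j := by
  have h1 : ∏ j, (1 - 2 * e j) = ∑ W : Finset (Fin d), (-2) ^ W.card * ∏ j ∈ W, e j := by
    have : ∀ j, 1 - 2 * e j = 1 + (-2) * e j := fun j => by ring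
    simp only [this]
    rw [Finset.prod_one_add, Finset.powerset_univ]
    exact Finset.sum_congr rfl fun W _ => by rw [Finset.prod_mul_distrib, Finset.prod_const]
  have h2 : ∀ W : Finset (Fin d), parityCoeff W * ∏ j ∈ W, e j =
      (if W = ∅ then 1 / 2 else 0) - ((-2) ^ W.card * ∏ j ∈ W, e j) / 2 := by
    intro W
    by_cases hW : W = ∅
    · subst hW
      simp [parityCoeff]
    · simp only [parityCoeff, hW, if_false]
      ring
  simp only [h2, Finset.sum_sub_distrib, ← Finset.sum_div, ← h1]
  simp only [Finset.sum_ite_eq', Finset.mem_univ, if_true]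
  ring

lemma norm_parityCoeff_le {d : ℕ} (W : Finset (Fin d)) : ‖parityCoeff W‖ ≤ 2 ^ d := by
  rw [parityCoeff]
  split_ifs with h
  · simp
  · have h1 : ‖(-(-2) ^ W.card / 2 : ℂ)‖ = 2 ^ W.card / 2 := by simp
    rw [h1]
    have h2 : W.card ≤ d := by simpa using W.card_le_univ
    have h3 : (2 : ℝ) ^ W.card ≤ 2 ^ d := pow_le_pow_right₀ one_le_two h2
    have h4 : (0 : ℝ) ≤ 2 ^ W.card := by positivity
    linarith

end Parity

/-! ### Path expansion of alternating products -/

lemma exists_path_coeff_mulVec {A : Type} [Fintype A] [DecidableEq A] {d : ℕ}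
    (N : Fin d → Matrix A A ℂ) (v : A → ℂ) :
    ∃ c : (Fin d → A) → A → ℂ, ∀ (g : Fin d → A → ℂ) (b : A),
      ((List.ofFn fun j => N j * Matrix.diagonal (g j)).prod *ᵥ v) b =
        ∑ a, c a b * ∏ j, g j (a j) := by
  induction d with
  | zero => exact ⟨fun _ => v, fun g b => by simp⟩
  | succ d ih =>
    obtain ⟨c, hc⟩ := ih fun j => N j.succ
    refine ⟨fun a b => N 0 b (a 0) * c (fun j => a j.succ) (a 0), fun g b => ?_⟩
    rw [List.ofFn_succ, List.prod_cons, ← Matrix.mulVec_mulVec,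
      ← Equiv.sum_comp (Fin.consEquiv fun _ => A), Fintype.sum_prod_type]
    simp only [Matrix.mulVec, dotProduct, Matrix.mul_diagonal]
    refine Finset.sum_congr rfl fun b' _ => ?_
    have := hc (fun j => g j.succ) b'
    simp only [Matrix.mulVec, dotProduct] at this
    rw [this, Finset.mul_sum]
    refine Finset.sum_congr rfl fun a _ => ?_
    simp only [Fin.consEquiv_apply, Fin.cons_zero, Fin.cons_succ, Fin.prod_univ_succ]
    ring

/-- An alternating product of matrices and diagonal matrices is a sum over paths, with
coefficients that do not depend on the diagonal entries. -/
lemma exists_path_coeff {A : Type} [Fintype A] [DecidableEq A] {d : ℕ}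
    (N : Fin d → Matrix A A ℂ) (u v : A → ℂ) :
    ∃ c : (Fin d → A) → ℂ, ∀ g : Fin d → A → ℂ,
      star u ⬝ᵥ ((List.ofFn fun j => N j * Matrix.diagonal (g j)).prod *ᵥ v) =
        ∑ a, c a * ∏ j, g j (a j) := by
  obtain ⟨c, hc⟩ := exists_path_coeff_mulVec N v
  refine ⟨fun a => ∑ b, star (u b) * c a b, fun g => ?_⟩
  simp only [dotProduct, hc, Pi.star_apply, Finset.mul_sum, Finset.sum_mul]
  rw [Finset.sum_comm]
  simp only [mul_assoc]

/-! ### Fourier weight of layered functions -/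

section Layered

variable {A V : Type} [Fintype A] [DecidableEq A] [Fintype V] [DecidableEq V]

/-- Diagonal entries of a layer: a phase `c a` times the character of the set `T a`. -/
def phase (c : A → ℂ) (T : A → Finset V) (y : V → ℤˣ) (a : A) : ℂ :=
  c a * ∏ w ∈ T a, ((y w : ℤ) : ℂ)

/-- The alternating product of `d` contractions and `d` phase layers, between two vectors. -/
def layered {d : ℕ} (u v : A → ℂ) (N : Fin d → Matrix A A ℂ) (c : A → ℂ) (T : A → Finset V)
    (y : V → ℤˣ) : ℂ :=
  star u ⬝ᵥ ((List.ofFn fun j => N j * Matrix.diagonal (phase c T y)).prod *ᵥ v)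

/-- The layers of the term that belongs to `y` and to the pattern `p`: the variable number `s` is
required to occur in every layer of `p s`. -/
def patternLayers {d ℓ : ℕ} (N : Fin d → Matrix A A ℂ) (c : A → ℂ) (T : A → Finset V)
    (y : V → ℤˣ) (p : Fin ℓ → Finset (Fin d)) : List (Matrix A A ℂ × Finset (Fin ℓ)) :=
  List.ofFn fun j => (N j * Matrix.diagonal (phase c T y), Finset.univ.filter fun s => j ∈ p s)

/-- Expansion of a Fourier coefficient over the inputs `y` and over the patterns `p`. -/
lemma fourierCoeff_layered {d ℓ : ℕ} (u v : A → ℂ) (N : Fin d → Matrix A A ℂ) (c : A → ℂ)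
    (T : A → Finset V) {i : Fin ℓ → V} (hi : Function.Injective i) :
    fourierCoeff (layered u v N c T) (Finset.univ.image i) =
      (∑ y : V → ℤˣ, ∑ p : Fin ℓ → Finset (Fin d), (∏ s, ((y (i s) : ℤ) : ℂ)) *
        (∏ s, parityCoeff (p s)) *
          (star u ⬝ᵥ (layerProd T (patternLayers N c T y p) i *ᵥ v))) / 2 ^ Fintype.card V := by
  obtain ⟨C, hC⟩ := exists_path_coeff N u v
  rw [fourierCoeff]
  congr 1
  simp only [layered, hC fun _ => phase c T _]
  have hpat : ∀ (y : V → ℤˣ) (p : Fin ℓ → Finset (Fin d)),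
      star u ⬝ᵥ (layerProd T (patternLayers N c T y p) i *ᵥ v) =
        ∑ a, C a * ((∏ j, phase c T y (a j)) *
          ∏ s, ∏ j ∈ p s, if i s ∈ T (a j) then 1 else 0) := by
    intro y p
    have hg := hC fun j a => phase c T y a * if ∀ s ∈ ({s | j ∈ p s} : Finset (Fin ℓ)),
      i s ∈ T a then 1 else 0
    have hlist : layerProd T (patternLayers N c T y p) i =
        (List.ofFn fun j => N j * Matrix.diagonal fun a => phase c T y a *
          if ∀ s ∈ ({s | j ∈ p s} : Finset (Fin ℓ)), i s ∈ T a then 1 else 0).prod := by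
      rw [layerProd, patternLayers, List.map_ofFn]
      congr 2
      funext j
      simp only [Function.comp, mask, Matrix.mul_assoc, Matrix.diagonal_mul_diagonal]
      congr!
    rw [hlist, hg]
    refine Finset.sum_congr rfl fun a _ => ?_
    rw [Finset.prod_mul_distrib]
    congr 2
    have h1 : ∀ s, (∏ j ∈ p s, if i s ∈ T (a j) then (1 : ℂ) else 0) =
        ∏ j, if j ∈ p s then (if i s ∈ T (a j) then (1 : ℂ) else 0) else 1 := fun s => by
      rw [Finset.prod_ite_mem, Finset.univ_inter]
    simp only [h1]
    rw [Finset.prod_comm]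
    refine Finset.prod_congr rfl fun j _ => ?_
    rw [← Finset.prod_filter, Finset.prod_ite_zero]
    simp
  have hpath : ∀ a : Fin d → A,
      ∑ y : V → ℤˣ, (∏ j, phase c T y (a j)) * ∏ s, ((y (i s) : ℤ) : ℂ) =
        ∑ y : V → ℤˣ, ((∏ j, phase c T y (a j)) * ∏ s, ((y (i s) : ℤ) : ℂ)) *
          ∑ p : Fin ℓ → Finset (Fin d), (∏ s, parityCoeff (p s)) *
            ∏ s, ∏ j ∈ p s, if i s ∈ T (a j) then 1 else 0 := by
    intro a
    have h := sum_prod_char_mul_char (Finset.univ.image i) fun j => T (a j)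
    simp only [Finset.prod_image hi.injOn, parity_eq_sum] at h
    rw [Finset.prod_univ_sum] at h
    simp only [Fintype.piFinset_univ, Finset.prod_mul_distrib] at h
    simp only [phase, Finset.prod_mul_distrib, mul_assoc, ← Finset.mul_sum] at h ⊢
    rw [h]
  simp only [hpat, Finset.prod_image hi.injOn, Finset.sum_mul, Finset.mul_sum]
  rw [Finset.sum_comm]
  have hswap : ∀ F : (Fin ℓ → Finset (Fin d)) → (Fin d → A) → ℂ,
    ∑ p, ∑ a, F p a = ∑ a, ∑ p, F p a := fun _ => Finset.sum_comm
  simp only [hswap]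
  rw [Finset.sum_comm (s := (Finset.univ : Finset (V → ℤˣ)))
    (t := (Finset.univ : Finset (Fin d → A)))]
  refine Finset.sum_congr rfl fun a _ => ?_
  have := congrArg (C a * ·) (hpath a)
  simp only [Finset.mul_sum] at this
  calc _ = _ := Finset.sum_congr rfl fun y _ => by ring
    _ = _ := this
    _ = _ := Finset.sum_congr rfl fun y _ => Finset.sum_congr rfl fun p _ => by ring

end Layered
section LayeredWeight

variable {A V : Type} [Fintype A] [DecidableEq A] [Fintype V] [DecidableEq V]

lemma fourierWeight_le_sum_injective (ℓ : ℕ) (f : (V → ℤˣ) → ℂ) :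
    fourierWeight ℓ f ≤ ∑ i : Fin ℓ → V with Function.Injective i,
      ‖fourierCoeff f (Finset.univ.image i)‖ := by
  have hmaps : ∀ i ∈ (Finset.univ.filter fun i : Fin ℓ → V => Function.Injective i),
      Finset.univ.image i ∈ Finset.powersetCard ℓ (Finset.univ : Finset V) := by
    intro i hi
    rw [Finset.mem_filter] at hi
    simp [Finset.mem_powersetCard, Finset.card_image_of_injective _ hi.2]
  rw [fourierWeight, ← Finset.sum_fiberwise_of_maps_to hmaps]
  refine Finset.sum_le_sum fun S hS => ?_
  let e := S.equivFinOfCardEq (Finset.mem_powersetCard.1 hS).2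
  let i : Fin ℓ → V := fun s => (e.symm s : V)
  have hi : Function.Injective i := Subtype.val_injective.comp e.symm.injective
  have himage : Finset.univ.image i = S := by
    ext w
    simp only [Finset.mem_image, Finset.mem_univ, true_and]
    refine ⟨?_, fun hw => ⟨e ⟨w, hw⟩, by simp [i]⟩⟩
    rintro ⟨s, rfl⟩
    exact (e.symm s).2
  calc ‖fourierCoeff f S‖ = ‖fourierCoeff f (Finset.univ.image i)‖ := by rw [himage]
    _ ≤ _ := Finset.single_le_sum (f := fun i => ‖fourierCoeff f (Finset.univ.image i)‖)
        (fun _ _ => norm_nonneg _) (by simp [hi, himage])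

lemma norm_char (S : Finset V) (y : V → ℤˣ) : ‖∏ w ∈ S, ((y w : ℤ) : ℂ)‖ = 1 := by
  rw [norm_prod]
  refine Finset.prod_eq_one fun w _ => ?_
  rcases Int.units_eq_one_or (y w) with h | h <;> simp [h]

/-- The sum over all tuples of one term of the expansion. Some layer is required by at least
`ℓ / d` of the `ℓ` variables, and it serves as the pivot. -/
lemma sum_norm_patternLayers_le {d ℓ τ : ℕ} (hd : 0 < d) {u v : A → ℂ}
    (hu : ∑ a, ‖u a‖ ^ 2 ≤ 1) (hv : ∑ a, ‖v a‖ ^ 2 ≤ 1) {N : Fin d → Matrix A A ℂ}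
    (hN : ∀ j, ‖N j‖ ≤ 1) {c : A → ℂ} (hc : ∀ a, ‖c a‖ ≤ 1) {T : A → Finset V}
    (hT : ∀ a, (T a).card ≤ τ) (hτ : τ ≤ Fintype.card V) (y : V → ℤˣ)
    {p : Fin ℓ → Finset (Fin d)} (hp : ∀ s, p s ≠ ∅) :
    ∑ i, ‖star u ⬝ᵥ (layerProd T (patternLayers N c T y p) i *ᵥ v)‖ ≤
      √((τ : ℝ) ^ (2 * ℓ - (d - 1) * ℓ / d) * (Fintype.card V : ℝ) ^ ((d - 1) * ℓ / d)) := by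
  -- `K j` is the set of variables that layer `j` requires.
  let K : Fin d → Finset (Fin ℓ) := fun j => Finset.univ.filter fun s => j ∈ p s
  have hsum : ℓ ≤ ∑ j, (K j).card := by
    have h1 : ∑ j, (K j).card = ∑ s, (p s).card := by
      simp only [K, Finset.card_filter]
      rw [Finset.sum_comm]
      simp
    have h2 : ∑ _s : Fin ℓ, 1 ≤ ∑ s, (p s).card :=
      Finset.sum_le_sum fun s _ => Finset.card_pos.2 (Finset.nonempty_iff_ne_empty.2 (hp s))
    rw [h1]
    simpa using h2
  obtain ⟨j, hj⟩ : ∃ j, ℓ ≤ d * (K j).card := by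
    by_contra! hlt
    have : Nonempty (Fin d) := ⟨⟨0, hd⟩⟩
    have h1 : ∑ j, d * (K j).card < ∑ _j : Fin d, ℓ :=
      Finset.sum_lt_sum_of_nonempty Finset.univ_nonempty fun j _ => hlt j
    rw [← Finset.mul_sum, Finset.sum_const, Finset.card_univ, Fintype.card_fin, smul_eq_mul] at h1
    exact absurd (lt_of_mul_lt_mul_left h1 (Nat.zero_le d)) (not_lt.2 hsum)
  have hphase : ‖Matrix.diagonal (phase c T y)‖ ≤ 1 := by
    rw [Matrix.l2_opNorm_diagonal, pi_norm_le_iff_of_nonneg zero_le_one]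
    intro a
    rw [phase, norm_mul, norm_char, mul_one]
    exact hc a
  have hL : ∀ q ∈ patternLayers N c T y p, ‖q.1‖ ≤ 1 := by
    intro q hq
    rw [patternLayers, List.mem_ofFn] at hq
    obtain ⟨k, rfl⟩ := hq
    exact (Matrix.l2_opNorm_mul _ _).trans (mul_le_one₀ (hN k) (norm_nonneg _) hphase)
  have hcover : ∀ s, ∃ q ∈ patternLayers N c T y p, s ∈ q.2 := by
    intro s
    obtain ⟨k, hk⟩ := Finset.nonempty_iff_ne_empty.2 (hp s)
    exact ⟨_, (List.mem_ofFn' _ _).2 ⟨k, rfl⟩, by simpa using hk⟩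
  obtain ⟨b, hb, hle⟩ := sum_norm_layerProd_le hT hu hv (patternLayers N c T y p) hL hcover
    ((List.mem_ofFn' _ _).2 ⟨j, rfl⟩)
  change b + (K j).card ≤ _ at hb
  rw [Fintype.card_fin] at hb hle
  have hbβ : b ≤ (d - 1) * ℓ / d := by
    rw [Nat.le_div_iff_mul_le hd]
    obtain ⟨e, rfl⟩ : ∃ e, d = e + 1 := ⟨d - 1, by omega⟩
    rw [Nat.add_sub_cancel]
    nlinarith [Nat.mul_le_mul_left (e + 1) hb]
  have hβ : (d - 1) * ℓ / d ≤ ℓ :=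
    Nat.div_le_of_le_mul (Nat.mul_le_mul_right _ (Nat.sub_le _ _))
  refine hle.trans (Real.sqrt_le_sqrt ?_)
  obtain ⟨r, hr⟩ := Nat.exists_eq_add_of_le hbβ
  have hexp : 2 * ℓ - b = (2 * ℓ - (d - 1) * ℓ / d) + r := by omega
  rw [hexp, hr, pow_add, pow_add, mul_assoc, mul_comm ((Fintype.card V : ℝ) ^ b)]
  gcongr

/-- The bound for layered functions: the factor `2 ^ (2 * d * ℓ)` counts `2 ^ (d * ℓ)` patterns,
each with a coefficient of modulus at most `2 ^ (d * ℓ)`. -/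
lemma fourierWeight_layered_le {d ℓ τ : ℕ} (hd : 0 < d) {u v : A → ℂ}
    (hu : ∑ a, ‖u a‖ ^ 2 ≤ 1) (hv : ∑ a, ‖v a‖ ^ 2 ≤ 1) {N : Fin d → Matrix A A ℂ}
    (hN : ∀ j, ‖N j‖ ≤ 1) {c : A → ℂ} (hc : ∀ a, ‖c a‖ ≤ 1) {T : A → Finset V}
    (hT : ∀ a, (T a).card ≤ τ) (hτ : τ ≤ Fintype.card V) :
    fourierWeight ℓ (layered u v N c T) ≤ 2 ^ (2 * d * ℓ) *
      √((τ : ℝ) ^ (2 * ℓ - (d - 1) * ℓ / d) * (Fintype.card V : ℝ) ^ ((d - 1) * ℓ / d)) := by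
  set B := √((τ : ℝ) ^ (2 * ℓ - (d - 1) * ℓ / d) * (Fintype.card V : ℝ) ^ ((d - 1) * ℓ / d))
  let w : (Fin ℓ → Finset (Fin d)) → ℝ := fun p => ‖∏ s, parityCoeff (p s)‖
  let h : (V → ℤˣ) → (Fin ℓ → Finset (Fin d)) → (Fin ℓ → V) → ℝ := fun y p i =>
    ‖star u ⬝ᵥ (layerProd T (patternLayers N c T y p) i *ᵥ v)‖
  have hcoeff : ∀ i : Fin ℓ → V, Function.Injective i →
      ‖fourierCoeff (layered u v N c T) (Finset.univ.image i)‖ ≤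
        (∑ y, ∑ p, w p * h y p i) / 2 ^ Fintype.card V := by
    intro i hi
    rw [fourierCoeff_layered u v N c T hi, norm_div, norm_pow, Complex.norm_ofNat]
    gcongr
    refine (norm_sum_le _ _).trans (Finset.sum_le_sum fun y _ => ?_)
    refine (norm_sum_le _ _).trans (Finset.sum_le_sum fun p _ => ?_)
    rw [norm_mul, norm_mul, ← Finset.prod_image (f := fun x => ((y x : ℤ) : ℂ)) hi.injOn,
      norm_char, one_mul]
  have hterm : ∀ y p, w p * ∑ i, h y p i ≤ 2 ^ (d * ℓ) * B := by
    intro y p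
    by_cases hp : ∀ s, p s ≠ ∅
    · refine mul_le_mul ?_ (sum_norm_patternLayers_le hd hu hv hN hc hT hτ y hp)
        (Finset.sum_nonneg fun i _ => norm_nonneg _) (by positivity)
      simp only [w, norm_prod, pow_mul]
      refine (Finset.prod_le_prod (fun _ _ => norm_nonneg _)
        fun s _ => norm_parityCoeff_le (p s)).trans ?_
      simp
    · push Not at hp
      obtain ⟨s, hs⟩ := hp
      have : w p = 0 := by
        simp only [w, norm_eq_zero]
        exact Finset.prod_eq_zero (Finset.mem_univ s) (by simp [parityCoeff, hs])
      rw [this, zero_mul]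
      positivity
  calc fourierWeight ℓ (layered u v N c T)
      ≤ ∑ i : Fin ℓ → V with Function.Injective i, (∑ y, ∑ p, w p * h y p i) /
          2 ^ Fintype.card V :=
        (fourierWeight_le_sum_injective _ _).trans
          (Finset.sum_le_sum fun i hi => hcoeff i (Finset.mem_filter.1 hi).2)
    _ ≤ ∑ i : Fin ℓ → V, (∑ y, ∑ p, w p * h y p i) / 2 ^ Fintype.card V :=
        Finset.sum_le_sum_of_subset_of_nonneg (Finset.filter_subset _ _) fun i _ _ => by positivity
    _ = (∑ y, ∑ p, w p * ∑ i, h y p i) / 2 ^ Fintype.card V := by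
        rw [← Finset.sum_div, Finset.sum_comm]
        congr 1
        refine Finset.sum_congr rfl fun y _ => ?_
        rw [Finset.sum_comm]
        simp only [Finset.mul_sum]
    _ ≤ (∑ _y : V → ℤˣ, ∑ _p : Fin ℓ → Finset (Fin d), 2 ^ (d * ℓ) * B) /
          2 ^ Fintype.card V := by
        refine div_le_div_of_nonneg_right ?_ (by positivity)
        exact Finset.sum_le_sum fun y _ => Finset.sum_le_sum fun p _ => hterm y p
    _ = _ := by
        simp only [Finset.sum_const, Finset.card_univ, Fintype.card_fun, Fintype.card_finset,
          Fintype.card_fin, Fintype.card_units_int, nsmul_eq_mul, Nat.cast_pow, Nat.cast_ofNat]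
        rw [mul_div_cancel_left₀ _ (by positivity), ← pow_mul, ← mul_assoc, ← pow_add]
        congr 2
        ring

end LayeredWeight

/-! ### Restricted query functions as layered functions -/

section Query

variable {n t m : ℕ}

/-- The free variables which occur an odd number of times among the `t` queries of a basis
state. -/
def oddSet (ρ : Fin n → Option ℤˣ) (a : Idx n t m) : Finset (Free ρ) :=
  Finset.univ.filter fun w => Odd (Finset.univ.filter fun k => a.1 k = w.1).card

/-- The product of the fixed signs among the `t` queries of a basis state. -/
def fixedSign (ρ : Fin n → Option ℤˣ) (a : Idx n t m) : ℂ :=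
  ∏ k, ((((ρ (a.1 k)).getD 1 : ℤˣ) : ℤ) : ℂ)

lemma card_oddSet_le (ρ : Fin n → Option ℤˣ) (a : Idx n t m) : (oddSet ρ a).card ≤ t := by
  have hsub : (oddSet ρ a).map (Function.Embedding.subtype _) ⊆ Finset.univ.image a.1 := by
    intro w hw
    rw [Finset.mem_map] at hw
    obtain ⟨x, hx, rfl⟩ := hw
    obtain ⟨k, hk⟩ := Finset.card_pos.1 (Finset.mem_filter.1 hx).2.pos
    exact Finset.mem_image.2 ⟨k, Finset.mem_univ _, (Finset.mem_filter.1 hk).2⟩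
  have h := (Finset.card_le_card hsub).trans Finset.card_image_le
  simpa using h

lemma norm_fixedSign (ρ : Fin n → Option ℤˣ) (a : Idx n t m) : ‖fixedSign ρ a‖ = 1 := by
  rw [fixedSign, norm_prod]
  refine Finset.prod_eq_one fun k _ => ?_
  rcases Int.units_eq_one_or ((ρ (a.1 k)).getD 1) with h | h <;> simp [h]

lemma queryLayer_eq_diagonal (x : Fin n → ℤˣ) :
    queryLayer t m x = Matrix.diagonal fun a => ∏ k, ((x (a.1 k) : ℤ) : ℂ) := by
  ext a b
  rw [queryLayer, Matrix.kroneckerMap_apply, tensorPow, Matrix.of_apply]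
  by_cases hab : a = b
  · subst hab
    simp [oracle]
  · rw [Matrix.diagonal_apply_ne _ hab]
    by_cases h2 : a.2 = b.2
    · obtain ⟨k, hk⟩ := Function.ne_iff.1 fun h1 : a.1 = b.1 => hab (Prod.ext h1 h2)
      rw [Finset.prod_eq_zero (Finset.mem_univ k), zero_mul]
      rw [oracle, Matrix.diagonal_apply_ne _ hk]
    · rw [Matrix.one_apply_ne h2, mul_zero]

/-- Under a restriction, a query layer is a diagonal matrix of signs times characters of the odd
sets: repeated queries to a free variable cancel in pairs. -/
lemma queryLayer_restrict (ρ : Fin n → Option ℤˣ) (y : Free ρ → ℤˣ) :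
    queryLayer t m (fun i => if h : ρ i = none then y ⟨i, h⟩ else (ρ i).getD 1) =
      Matrix.diagonal (phase (fixedSign ρ) (oddSet ρ) y) := by
  rw [queryLayer_eq_diagonal]
  congr 1
  funext a
  have hval : ∀ i, (((if h : ρ i = none then y ⟨i, h⟩ else (ρ i).getD 1 : ℤˣ) : ℤ) : ℂ) =
      (((ρ i).getD 1 : ℤˣ) : ℤ) * ∏ w : Free ρ, if i = w.1 then ((y w : ℤ) : ℂ) else 1 := by
    intro i
    by_cases h : ρ i = none
    · have hw : ∀ w : Free ρ, (i = w.1) = (w = ⟨i, h⟩) := fun w => by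
        rw [Subtype.ext_iff]
        exact propext eq_comm
      simp only [hw, Finset.prod_ite_eq', Finset.mem_univ, if_true, h, dif_pos,
        Option.getD_none, Units.val_one, Int.cast_one, one_mul]
    · rw [dif_neg h, Finset.prod_eq_one, mul_one]
      intro w _
      rw [if_neg]
      rintro rfl
      exact h w.2
  simp only [hval, Finset.prod_mul_distrib, phase, fixedSign]
  congr 1
  rw [Finset.prod_comm, oddSet, Finset.prod_filter]
  refine Finset.prod_congr rfl fun w _ => ?_
  rw [← Finset.prod_filter, Finset.prod_const]
  rcases Int.units_eq_one_or (y w) with h | h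
  · simp [h]
  · simp only [h, Units.val_neg, Units.val_one, Int.cast_neg, Int.cast_one]
    split_ifs with hodd
    · exact hodd.neg_one_pow
    · exact (Nat.not_odd_iff_even.1 hodd).neg_one_pow

/-- A matrix `1` in front of the first query layer makes the numbers of matrices and of query
layers equal. -/
lemma restrict_queryFun {e : ℕ} (u v : EuclideanSpace ℂ (Idx n t m))
    (M : Fin e → Matrix (Idx n t m) (Idx n t m) ℂ) (ρ : Fin n → Option ℤˣ) :
    restrict (queryFun (d := e + 1) u v M) ρ =
      layered u.ofLp v.ofLp (Fin.cons 1 M : Fin (e + 1) → Matrix (Idx n t m) (Idx n t m) ℂ)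
        (fixedSign ρ) (oddSet ρ) := by
  funext y
  rw [restrict, queryFun, layered, List.ofFn_succ, List.prod_cons]
  simp only [queryLayer_restrict, Fin.cons_zero, Fin.cons_succ, one_mul]
  rfl

end Query

/-- The case `n < t` is covered because a basis state has at most `min t n` distinct free variables
among its queries. -/
lemma sqrt_pow_mul_pow_le {t n ℓ β : ℕ} (ht : 1 ≤ t) (hβ : β ≤ ℓ) :
    √(((min t n : ℕ) : ℝ) ^ (2 * ℓ - β) * (n : ℝ) ^ β) ≤
      (t : ℝ) ^ ℓ * max 1 (((n : ℝ) / t) ^ ((1 / 2 : ℝ) * β)) := by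
  have ht0 : (0 : ℝ) < t := by exact_mod_cast ht
  rcases le_total n t with h | h
  · rw [min_eq_right h, ← pow_add, show 2 * ℓ - β + β = ℓ * 2 by omega, pow_mul,
      Real.sqrt_sq (by positivity)]
    calc (n : ℝ) ^ ℓ ≤ (t : ℝ) ^ ℓ := by gcongr
      _ ≤ _ := le_mul_of_one_le_right (by positivity) (le_max_left _ _)
  · rw [min_eq_left h]
    have h1 : (t : ℝ) ^ (2 * ℓ - β) * (n : ℝ) ^ β = ((t : ℝ) ^ ℓ) ^ 2 * ((n : ℝ) / t) ^ β := by
      rw [div_pow, ← pow_mul, show ℓ * 2 = (2 * ℓ - β) + β by omega, pow_add]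
      field_simp
    have h2 : √(((n : ℝ) / t) ^ β) = ((n : ℝ) / t) ^ ((1 / 2 : ℝ) * β) := by
      rw [Real.sqrt_eq_rpow, ← Real.rpow_natCast, ← Real.rpow_mul (by positivity), mul_comm]
    rw [h1, Real.sqrt_mul (by positivity), Real.sqrt_sq (by positivity), h2]
    gcongr
    exact le_max_right _ _

end QueryFourier

theorem theorem4p1 :
    ∃ κ : ℕ → ℕ → ℝ,
      (∃ C : ℝ, 0 < C ∧ ∀ d ℓ : ℕ, 2 ≤ d →
        0 ≤ κ d ℓ ∧
        κ d ℓ ≤ C * ((d : ℝ) * (ℓ : ℝ)) * min ((2 : ℝ) ^ (d * ℓ)) ((ℓ : ℝ) ^ (2 ^ d))) ∧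
      ∀ (n t m d : ℕ), 1 ≤ n → 1 ≤ t → 2 ≤ d →
      ∀ (u v : EuclideanSpace ℂ (QueryFourier.Idx n t m)), ‖u‖ = 1 → ‖v‖ = 1 →
      ∀ (M : Fin (d - 1) → Matrix (QueryFourier.Idx n t m) (QueryFourier.Idx n t m) ℂ),
        (∀ i, ‖M i‖ ≤ 1) →
      ∀ (ρ : Fin n → Option ℤˣ) (ℓ : ℕ),
        QueryFourier.fourierWeight ℓ
            (QueryFourier.restrict (QueryFourier.queryFun u v M) ρ) ≤
          (2 : ℝ) ^ κ d ℓ * (t : ℝ) ^ ℓ *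
            max 1 (((Fintype.card (QueryFourier.Free ρ) : ℝ) / (t : ℝ)) ^
              ((1 / 2 : ℝ) * (⌊((d : ℝ) - 1) * (ℓ : ℝ) / (d : ℝ)⌋₊ : ℝ))) := by
  refine ⟨fun d ℓ => ((2 * d * ℓ : ℕ) : ℝ), ⟨2, two_pos, fun d ℓ hd => ⟨by positivity, ?_⟩⟩, ?_⟩
  · rcases Nat.eq_zero_or_pos ℓ with rfl | hℓ
    · simp
    have hℓ' : (1 : ℝ) ≤ ℓ := by exact_mod_cast hℓ
    have hmin : 1 ≤ min ((2 : ℝ) ^ (d * ℓ)) ((ℓ : ℝ) ^ (2 ^ d)) :=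
      le_min (one_le_pow₀ one_le_two) (one_le_pow₀ hℓ')
    push_cast
    rw [mul_assoc]
    exact le_mul_of_one_le_right (by positivity) hmin
  intro n t m d _ ht hd u v hu hv M hM ρ ℓ
  obtain ⟨e, rfl⟩ : ∃ e, d = e + 1 := ⟨d - 1, by omega⟩
  have hunit : ∀ w : EuclideanSpace ℂ (QueryFourier.Idx n t m), ‖w‖ = 1 →
      ∑ a, ‖w.ofLp a‖ ^ 2 ≤ 1 := fun w hw => by
    rw [← EuclideanSpace.norm_sq_eq, hw, one_pow]
  have hN : ∀ j, ‖(Fin.cons 1 M : Fin (e + 1) →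
      Matrix (QueryFourier.Idx n t m) (QueryFourier.Idx n t m) ℂ) j‖ ≤ 1 := by
    refine Fin.cases ?_ fun j => ?_
    · rw [Fin.cons_zero, ← Matrix.diagonal_one, Matrix.l2_opNorm_diagonal,
        pi_norm_le_iff_of_nonneg zero_le_one]
      simp
    · rw [Fin.cons_succ]
      exact hM j
  have hfloor : ⌊(((e + 1 : ℕ) : ℝ) - 1) * (ℓ : ℝ) / ((e + 1 : ℕ) : ℝ)⌋₊ =
      (e + 1 - 1) * ℓ / (e + 1) := by
    rw [← Nat.floor_div_eq_div (K := ℝ)]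
    push_cast
    simp
  have hweight := QueryFourier.fourierWeight_layered_le (ℓ := ℓ) (τ := min t _) e.succ_pos
    (hunit u hu) (hunit v hv) hN (fun a => (QueryFourier.norm_fixedSign ρ a).le)
    (fun a => le_min (QueryFourier.card_oddSet_le ρ a) (Finset.card_le_univ _)) (min_le_right _ _)
  rw [hfloor, Real.rpow_natCast, mul_assoc, QueryFourier.restrict_queryFun]
  refine hweight.trans ?_
  gcongr
  exact QueryFourier.sqrt_pow_mul_pow_le ht
    (Nat.div_le_of_le_mul (Nat.mul_le_mul_right _ (Nat.sub_le _ _)))
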